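/- Let $n\ge 0$, let $\mathbf m=(m_1,\dots,m_n)$ be a vector of positive integers, and put $m=m_1+\cdots+m_n$. A generalized Stirling permutation of the multiset $\{1^{m_1},2^{m_2},\dots,n^{m_n}\}$ is an arrangement $\pi=\pi_1\pi_2\cdots\pi_m$ of this multiset such that, for each $k\in\{1,\dots,n\}$, all entries between two consecutive occurrences of $k$ are larger than $k$. Let $\mathcal Q_{\mathbf m}$ be the set of all of them. With the convention $\pi_0=\pi_{m+1}=0$, let $\mathrm{des}(\pi)$ be the number of indices $0\le j\le m$ with $\pi_j>\pi_{j+1}$ (descents) and $\mathrm{plat}(\pi)$ the number of indices $0\le j\le m$ with $\pi_j=\pi_{j+1}$ (plateaux). Define $$S_{\mathbf m,i}(x)=\sum_{\pi\in\mathcal Q_{\mathbf m},\ \mathrm{plat}(\pi)=i}x^{\mathrm{des}(\pi)}.$$ **Corollary 3.3.** For every such $\mathbf m$ and every integer $i$ with $0\le i\le m-1$, the polynomial $S_{\mathbf m,i}(x)$ has only real roots; that is, it is identically zero or all of its complex roots are real. -/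

import Mathlib

namespace GenStirling

open Polynomial

/-- The multiset `{1^{m_1}, 2^{m_2}, …, n^{m_n}}`; the index `k : Fin n` stands for the letter
`k + 1`. -/
def letters {n : ℕ} (m : Fin n → ℕ) : Multiset ℕ :=
  ∑ k : Fin n, Multiset.replicate (m k) ((k : ℕ) + 1)

/-- The Stirling condition: no entry that lies between two occurrences of a letter `a` is smaller
than `a`. Equivalently, all entries between two consecutive occurrences of `a` are larger
than `a`. -/
def IsStirling (w : List ℕ) : Prop :=
  ∀ i k j : Fin w.length, i < k → k < j → w[i] = w[j] → w[i] ≤ w[k]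

instance : DecidablePred IsStirling := fun w => by
  unfold IsStirling
  infer_instance

/-- `Q m`: the set of all generalized Stirling permutations of the multiset `letters m`. -/
def Q {n : ℕ} (m : Fin n → ℕ) : Finset (List ℕ) :=
  {w ∈ (letters m).lists.toFinset | IsStirling w}

/-- The entry `π_i` of the word `w = π_1 ⋯ π_M`, with `π_0 = 0` and `π_i = 0` for `i > M`. -/
def entry (w : List ℕ) (i : ℕ) : ℕ :=
  (0 :: w).getD i 0

/-- The number of descents: indices `0 ≤ i ≤ M` with `π_i > π_{i+1}`. -/
def des (w : List ℕ) : ℕ :=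
  Finset.card {i ∈ Finset.range (w.length + 1) | entry w i > entry w (i + 1)}

/-- The number of plateaux: indices `0 ≤ i ≤ M` with `π_i = π_{i+1}`. -/
def plat (w : List ℕ) : ℕ :=
  Finset.card {i ∈ Finset.range (w.length + 1) | entry w i = entry w (i + 1)}

/-- The refined descent polynomial `S_{m,i}(x) = ∑ x^{des π}`, the sum running over all
generalized Stirling permutations `π ∈ Q m` with exactly `i` plateaux. -/
noncomputable def S {n : ℕ} (m : Fin n → ℕ) (i : ℕ) : ℝ[X] :=
  ∑ w ∈ Q m with plat w = i, X ^ des w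

/-- A real polynomial has only real roots: each of its complex roots is real. The zero
polynomial is counted as having only real roots, as usual. -/
def HasOnlyRealRoots (p : ℝ[X]) : Prop :=
  p = 0 ∨ ∀ z : ℂ, aeval z p = 0 → z.im = 0

end GenStirling

namespace GenStirling

open Polynomial

/-- The closed upper half-plane is preserved as a zero-free region by differentiation
(Gauss–Lucas). -/
theorem derivative_eval_ne_zero {q : ℂ[X]} (hq : ∀ t : ℂ, 0 ≤ t.im → q.eval t ≠ 0)
    (hd : 0 < q.natDegree) {t : ℂ} (ht : 0 ≤ t.im) : (derivative q).eval t ≠ 0 := by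
  intro h0
  have hd0 : derivative q ≠ 0 := by
    intro h
    have := derivative_eq_zero.1 h
    omega
  have h1 : t ∈ (derivative q).rootSet ℂ := by
    rw [mem_rootSet_of_ne hd0]
    simpa using h0
  have h2 := rootSet_derivative_subset_convexHull_rootSet (natDegree_pos_iff_degree_pos.1 hd) h1
  have h3 : convexHull ℝ (q.rootSet ℂ) ⊆ {z : ℂ | z.im < 0} := by
    refine convexHull_min ?_ (convex_halfSpace_im_lt 0)
    intro z hz
    by_contra hz'
    have := (mem_rootSet.1 hz).2
    exact hq z (not_lt.1 hz') (by simpa using this)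
  exact absurd (h3 h2) (not_lt.2 ht)

theorem iterate_derivative_eval_ne_zero {q : ℂ[X]} (i : ℕ) (hi : i ≤ q.natDegree)
    (hq : ∀ t : ℂ, 0 ≤ t.im → q.eval t ≠ 0) :
    ∀ t : ℂ, 0 ≤ t.im → (derivative^[i] q).eval t ≠ 0 := by
  induction i generalizing q with
  | zero => simpa using hq
  | succ i ih =>
    intro t ht
    rw [Function.iterate_succ_apply]
    refine ih ?_ (fun s hs => derivative_eval_ne_zero hq (by omega) hs) t ht
    rw [natDegree_derivative]
    omega

theorem coeff_ne_zero_of_eval_ne_zero {q : ℂ[X]} {i : ℕ} (hi : i ≤ q.natDegree)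
    (hq : ∀ t : ℂ, 0 ≤ t.im → q.eval t ≠ 0) : q.coeff i ≠ 0 := by
  have h := iterate_derivative_eval_ne_zero i hi hq 0 le_rfl
  rw [← coeff_zero_eq_eval_zero, coeff_iterate_derivative] at h
  intro h0
  simp [h0] at h

/-- A polynomial without roots in a disc is controlled everywhere by its value at the centre. -/
theorem norm_eval_le_of_ball_ne_zero {p : ℂ[X]} {D : ℕ} (hD : p.natDegree ≤ D) {z : ℂ} {δ : ℝ}
    (hδ : 0 < δ) (hp : ∀ w ∈ Metric.ball z δ, p.eval w ≠ 0) (w : ℂ) :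
    ‖p.eval w‖ ≤ ‖p.eval z‖ * (1 + ‖w - z‖ / δ) ^ D := by
  have hs := IsAlgClosed.splits p
  have hp0 : p ≠ 0 := by
    rintro rfl
    exact hp z (Metric.mem_ball_self hδ) (by simp)
  have hnorm : ∀ x : ℂ, ‖p.eval x‖ =
      ‖p.leadingCoeff‖ * (p.roots.map fun r => ‖x - r‖).prod := by
    intro x
    rw [hs.eval_eq_prod_roots, norm_mul]
    congr 1
    have := map_multiset_prod (normHom : ℂ →*₀ ℝ) (p.roots.map fun r => x - r)
    rw [Multiset.map_map] at this
    exact this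
  have hroot : (p.roots.map fun r => ‖w - r‖).prod ≤
      (p.roots.map fun r => ‖z - r‖ * (1 + ‖w - z‖ / δ)).prod := by
    refine Multiset.prod_map_le_prod_map₀ _ _ (fun r _ => norm_nonneg _) fun r hr => ?_
    have h1 : δ ≤ ‖z - r‖ := by
      by_contra h
      refine hp r ?_ (isRoot_of_mem_roots hr)
      rw [Metric.mem_ball, dist_comm, dist_eq_norm]
      exact not_le.1 h
    have h2 : ‖w - r‖ ≤ ‖z - r‖ + ‖w - z‖ := by
      rw [add_comm, show w - r = (w - z) + (z - r) by ring]
      exact norm_add_le _ _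
    have h3 : ‖w - z‖ ≤ ‖z - r‖ * (‖w - z‖ / δ) := by
      rw [mul_div_assoc', le_div_iff₀ hδ, mul_comm]
      exact mul_le_mul_of_nonneg_right h1 (norm_nonneg _)
    linarith
  have h1 : (1 : ℝ) ≤ 1 + ‖w - z‖ / δ := le_add_of_nonneg_right (by positivity)
  rw [hnorm w, hnorm z]
  calc _ ≤ ‖p.leadingCoeff‖ * (p.roots.map fun r => ‖z - r‖ * (1 + ‖w - z‖ / δ)).prod := by
        gcongr
    _ = ‖p.leadingCoeff‖ * (p.roots.map fun r => ‖z - r‖).prod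
          * (1 + ‖w - z‖ / δ) ^ p.natDegree := by
        rw [Multiset.prod_map_mul, Multiset.map_const', Multiset.prod_replicate,
          hs.natDegree_eq_card_roots, mul_assoc]
    _ ≤ _ := by
        refine mul_le_mul_of_nonneg_left (pow_le_pow_right₀ h1 hD) ?_
        rw [← hnorm]
        exact norm_nonneg _

/-- Hurwitz's theorem for a polynomial family `f(ε, ·)`, `ε → 0⁺`. -/
theorem map_evalRingHom_zero_of_evalEval_ne_zero {f : ℂ[X][X]} {z : ℂ} {δ : ℝ} (hδ : 0 < δ)
    (hf : ∀ ε : ℝ, 0 < ε → ∀ w ∈ Metric.ball z δ, f.evalEval (ε : ℂ) w ≠ 0)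
    (h0 : f.evalEval 0 z = 0) : f.map (evalRingHom 0) = 0 := by
  have hcont : ∀ w : ℂ, Filter.Tendsto (fun ε : ℝ => ‖f.evalEval (ε : ℂ) w‖)
      (nhdsWithin 0 (Set.Ioi 0)) (nhds ‖f.evalEval 0 w‖) := by
    intro w
    have hc : Continuous fun ε : ℝ => ‖f.evalEval (ε : ℂ) w‖ :=
      ((f.eval (C w)).continuous.comp Complex.continuous_ofReal).norm
    have := (hc.tendsto 0).mono_left (nhdsWithin_le_nhds (s := Set.Ioi 0))
    simpa using this
  refine Polynomial.funext fun w => ?_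
  have hle : ‖f.evalEval 0 w‖ ≤ ‖f.evalEval 0 z‖ * (1 + ‖w - z‖ / δ) ^ f.natDegree := by
    refine le_of_tendsto_of_tendsto (hcont w) ((hcont z).mul_const _) ?_
    filter_upwards [self_mem_nhdsWithin] with ε hε
    have := norm_eval_le_of_ball_ne_zero (p := f.map (evalRingHom (ε : ℂ)))
      natDegree_map_le hδ (z := z) (fun v hv => by
        rw [map_evalRingHom_eval]
        exact hf ε hε v hv) w
    simpa only [map_evalRingHom_eval] using this
  rw [h0, norm_zero, zero_mul] at hle
  rw [map_evalRingHom_eval, eval_zero]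
  exact norm_le_zero_iff.1 hle

/-- The number of indices `0 ≤ i ≤ M` with `R π_i π_{i+1}`. -/
def relCount (R : ℕ → ℕ → Prop) [DecidableRel R] (w : List ℕ) : ℕ :=
  Finset.card {i ∈ Finset.range (w.length + 1) | R (entry w i) (entry w (i + 1))}

/-- The number of adjacent pairs `a, b` of a list with `R a b`. -/
def adjCount (R : ℕ → ℕ → Prop) [DecidableRel R] : List ℕ → ℕ
  | a :: b :: l => (if R a b then 1 else 0) + adjCount R (b :: l)
  | _ => 0

section adjCount

variable (R : ℕ → ℕ → Prop) [DecidableRel R]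

theorem adjCount_cons_eq_sum (a : ℕ) (l : List ℕ) :
    adjCount R (a :: l) = ∑ i ∈ Finset.range l.length,
      if R ((a :: l).getD i 0) ((a :: l).getD (i + 1) 0) then 1 else 0 := by
  induction l generalizing a with
  | nil => simp [adjCount]
  | cons b l ih =>
    rw [adjCount, ih, List.length_cons, Finset.sum_range_succ', add_comm]
    simp

theorem entry_eq_getD_append (w : List ℕ) (i : ℕ) : entry w i = (0 :: (w ++ [0])).getD i 0 := by
  unfold entry
  rw [← List.cons_append]
  rcases lt_or_ge i (0 :: w).length with h | h
  · rw [List.getD_append _ _ _ _ h]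
  · rw [List.getD_append_right _ _ _ _ h, List.getD_eq_default _ _ h]
    cases i - (0 :: w).length <;> simp

theorem relCount_eq_adjCount (w : List ℕ) : relCount R w = adjCount R (0 :: (w ++ [0])) := by
  rw [relCount, Finset.card_filter, adjCount_cons_eq_sum]
  simp [entry_eq_getD_append]

theorem adjCount_append_cons (A B : List ℕ) (a : ℕ) :
    adjCount R (A ++ a :: B) = adjCount R (A ++ [a]) + adjCount R (a :: B) := by
  induction A with
  | nil => simp [adjCount]
  | cons c A ih =>
    cases A with
    | nil => simp [adjCount]
    | cons d A =>
      simp only [List.cons_append, adjCount] at ih ⊢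
      rw [ih, add_assoc]

theorem adjCount_cons_replicate_append (a b N k : ℕ) :
    adjCount R (a :: (List.replicate (k + 1) N ++ [b])) =
      (if R a N then 1 else 0) + k * (if R N N then 1 else 0) + (if R N b then 1 else 0) := by
  rw [List.replicate_succ, List.cons_append, adjCount, add_assoc]
  congr 1
  induction k with
  | zero => simp [adjCount]
  | succ k ih =>
    rw [List.replicate_succ, List.cons_append, adjCount, ih]
    ring

end adjCount

/-- Insert the block `N^k` into the `j`-th gap of `v`. -/
def insertBlock (N k : ℕ) (v : List ℕ) (j : ℕ) : List ℕ :=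
  v.take j ++ (List.replicate k N ++ v.drop j)

theorem exists_split_at_gap {v : List ℕ} {j : ℕ} (hj : j ≤ v.length) :
    ∃ A B : List ℕ, (∀ w, 0 :: (v.take j ++ (w ++ (v.drop j ++ [0]))) =
      A ++ entry v j :: (w ++ entry v (j + 1) :: B)) := by
  have h1 : ∃ A, 0 :: v.take j = A ++ [entry v j] := by
    refine ⟨(0 :: v).take j, ?_⟩
    have hj' : j < (0 :: v).length := by simp; omega
    rw [entry, List.getD_eq_getElem _ _ hj', List.take_append_getElem hj', List.take_succ_cons]
  have h2 : ∃ B, v.drop j ++ [0] = entry v (j + 1) :: B := by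
    rcases hj.lt_or_eq with h | h
    · refine ⟨v.drop (j + 1) ++ [0], ?_⟩
      rw [entry, List.getD_cons_succ, List.getD_eq_getElem _ _ h, List.drop_eq_getElem_cons h]
      rfl
    · subst h
      exact ⟨[], by simp [entry]⟩
  obtain ⟨A, hA⟩ := h1
  obtain ⟨B, hB⟩ := h2
  refine ⟨A, B, fun w => ?_⟩
  rw [hB, ← List.cons_append, hA]
  simp

theorem relCount_insertBlock (R : ℕ → ℕ → Prop) [DecidableRel R] {v : List ℕ} {j : ℕ}
    (hj : j ≤ v.length) (N k : ℕ) :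
    relCount R (insertBlock N (k + 1) v j) + (if R (entry v j) (entry v (j + 1)) then 1 else 0) =
      relCount R v + ((if R (entry v j) N then 1 else 0) + k * (if R N N then 1 else 0) +
        (if R N (entry v (j + 1)) then 1 else 0)) := by
  obtain ⟨A, B, h⟩ := exists_split_at_gap hj
  have h1 := h (List.replicate (k + 1) N)
  have h2 := h []
  simp only [List.nil_append] at h2
  rw [← List.append_assoc, List.take_append_drop] at h2
  rw [relCount_eq_adjCount, relCount_eq_adjCount, insertBlock, List.append_assoc,
    List.append_assoc, h1, h2, adjCount_append_cons R A,
    adjCount_append_cons R A (entry v (j + 1) :: B), adjCount.eq_1 R (entry v j)]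
  rw [← List.cons_append, adjCount_append_cons R (entry v j :: List.replicate (k + 1) N) B,
    List.cons_append, adjCount_cons_replicate_append]
  ring

/-- The number of ascents, counted with `π_0 = π_{M+1} = 0`. -/
def asc (w : List ℕ) : ℕ := relCount (· < ·) w

theorem des_eq_relCount (w : List ℕ) : des w = relCount (· > ·) w := rfl

theorem plat_eq_relCount (w : List ℕ) : plat w = relCount (· = ·) w := rfl

theorem entry_lt {v : List ℕ} {N : ℕ} (hN : 0 < N) (hv : ∀ a ∈ v, a < N) (i : ℕ) :
    entry v i < N := by
  unfold entry
  rcases lt_or_ge i (0 :: v).length with h | h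
  · rw [List.getD_eq_getElem _ _ h]
    rcases List.mem_cons.1 (List.getElem_mem h) with h' | h'
    · omega
    · exact hv _ h'
  · rw [List.getD_eq_default _ _ h]
    exact hN

theorem des_insertBlock {v : List ℕ} {j N : ℕ} (hj : j ≤ v.length) (hN : 0 < N)
    (hv : ∀ a ∈ v, a < N) (k : ℕ) : des (insertBlock N (k + 1) v j) +
    (if entry v j > entry v (j + 1) then 1 else 0) = des v + 1 := by
  have h := relCount_insertBlock (· > ·) hj N k
  have h1 := entry_lt hN hv j
  have h2 := entry_lt hN hv (j + 1)
  simpa [des_eq_relCount, h1.not_gt, h2] using h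

theorem asc_insertBlock {v : List ℕ} {j N : ℕ} (hj : j ≤ v.length) (hN : 0 < N)
    (hv : ∀ a ∈ v, a < N) (k : ℕ) : asc (insertBlock N (k + 1) v j) +
    (if entry v j < entry v (j + 1) then 1 else 0) = asc v + 1 := by
  have h := relCount_insertBlock (· < ·) hj N k
  have h1 := entry_lt hN hv j
  have h2 := entry_lt hN hv (j + 1)
  simpa [asc, h1, h2.not_gt] using h

theorem plat_insertBlock {v : List ℕ} {j N : ℕ} (hj : j ≤ v.length) (hN : 0 < N)
    (hv : ∀ a ∈ v, a < N) (k : ℕ) : plat (insertBlock N (k + 1) v j) +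
    (if entry v j = entry v (j + 1) then 1 else 0) = plat v + k := by
  have h := relCount_insertBlock (· = ·) hj N k
  have h1 := entry_lt hN hv j
  have h2 := entry_lt hN hv (j + 1)
  simpa [plat_eq_relCount, h1.ne, h2.ne'] using h

theorem des_add_asc_add_plat (w : List ℕ) : des w + asc w + plat w = w.length + 1 := by
  rw [des_eq_relCount, plat_eq_relCount, asc]
  unfold relCount
  simp only [Finset.card_filter]
  rw [← Finset.sum_add_distrib, ← Finset.sum_add_distrib, Finset.sum_congr rfl (g := fun _ => 1)]
  · simp
  · intro i _
    rcases lt_trichotomy (entry w i) (entry w (i + 1)) with h | h | h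
    · simp [h, h.ne, h.not_gt]
    · simp [h]
    · simp [h, h.ne', h.not_gt]

/-- Summing the weight `x^des y^asc z^plat` over all insertions of a block of a new largest
letter into a given word. -/
theorem sum_insertBlock {R : Type*} [CommSemiring R] (x y z : R) {v : List ℕ} {N : ℕ} (hN : 0 < N)
    (hv : ∀ a ∈ v, a < N) (k : ℕ) :
    ∑ j ∈ Finset.range (v.length + 1), x ^ des (insertBlock N (k + 1) v j) *
      y ^ asc (insertBlock N (k + 1) v j) * z ^ plat (insertBlock N (k + 1) v j) =
    z ^ k * (x * y) * (des v * x ^ (des v - 1) * y ^ asc v * z ^ plat v +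
      asc v * x ^ des v * y ^ (asc v - 1) * z ^ plat v +
      plat v * x ^ des v * y ^ asc v * z ^ (plat v - 1)) := by
  have hterm : ∀ j ∈ Finset.range (v.length + 1), x ^ des (insertBlock N (k + 1) v j) *
      y ^ asc (insertBlock N (k + 1) v j) * z ^ plat (insertBlock N (k + 1) v j) =
      z ^ k * (x * y) * ((if entry v j > entry v (j + 1) then 1 else 0) *
          (x ^ (des v - 1) * y ^ asc v * z ^ plat v) +
        (if entry v j < entry v (j + 1) then 1 else 0) *
          (x ^ des v * y ^ (asc v - 1) * z ^ plat v) +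
        (if entry v j = entry v (j + 1) then 1 else 0) *
          (x ^ des v * y ^ asc v * z ^ (plat v - 1))) := by
    intro j hj
    have hmem := hj
    rw [Finset.mem_range, Nat.lt_succ_iff] at hj
    have hd := des_insertBlock hj hN hv k
    have ha := asc_insertBlock hj hN hv k
    have hp := plat_insertBlock hj hN hv k
    rcases lt_trichotomy (entry v j) (entry v (j + 1)) with h | h | h
    · have hpos : 0 < asc v := by
        rw [asc, relCount]
        exact Finset.card_pos.2 ⟨j, Finset.mem_filter.2 ⟨hmem, h⟩⟩
      obtain ⟨s, hs⟩ := Nat.exists_eq_succ_of_ne_zero hpos.ne'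
      simp only [h, h.not_gt, h.ne, if_true, if_false] at hd ha hp ⊢
      rw [show des (insertBlock N (k + 1) v j) = des v + 1 by omega,
        show asc (insertBlock N (k + 1) v j) = s + 1 by omega,
        show plat (insertBlock N (k + 1) v j) = plat v + k by omega, hs, Nat.succ_sub_one]
      ring
    · have hpos : 0 < plat v := Finset.card_pos.2 ⟨j, Finset.mem_filter.2 ⟨hmem, h⟩⟩
      obtain ⟨s, hs⟩ := Nat.exists_eq_succ_of_ne_zero hpos.ne'
      simp only [h, lt_irrefl, if_true, if_false] at hd ha hp ⊢
      rw [show des (insertBlock N (k + 1) v j) = des v + 1 by omega,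
        show asc (insertBlock N (k + 1) v j) = asc v + 1 by omega,
        show plat (insertBlock N (k + 1) v j) = s + k by omega, hs, Nat.succ_sub_one]
      ring
    · have hpos : 0 < des v := Finset.card_pos.2 ⟨j, Finset.mem_filter.2 ⟨hmem, h⟩⟩
      obtain ⟨s, hs⟩ := Nat.exists_eq_succ_of_ne_zero hpos.ne'
      simp only [h, h.not_gt, h.ne', if_true, if_false] at hd ha hp ⊢
      rw [show des (insertBlock N (k + 1) v j) = s + 1 by omega,
        show asc (insertBlock N (k + 1) v j) = asc v + 1 by omega,
        show plat (insertBlock N (k + 1) v j) = plat v + k by omega, hs, Nat.succ_sub_one]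
      ring
  rw [Finset.sum_congr rfl hterm, ← Finset.mul_sum, Finset.sum_add_distrib,
    Finset.sum_add_distrib, ← Finset.sum_mul, ← Finset.sum_mul, ← Finset.sum_mul,
    Finset.sum_boole, Finset.sum_boole, Finset.sum_boole]
  simp only [des, asc, plat, relCount]
  ring

theorem isStirling_iff_sublist (w : List ℕ) :
    IsStirling w ↔ ∀ a b, [a, b, a].Sublist w → a ≤ b := by
  constructor
  · intro h a b hs
    obtain ⟨f, hf⟩ := List.sublist_iff_exists_fin_orderEmbedding_get_eq.1 hs
    have h0 := hf ⟨0, by simp⟩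
    have h1 := hf ⟨1, by simp⟩
    have h2 := hf ⟨2, by simp⟩
    simp only [List.get_eq_getElem, List.getElem_cons_zero, List.getElem_cons_succ] at h0 h1 h2
    have := h (f ⟨0, by simp⟩) (f ⟨1, by simp⟩) (f ⟨2, by simp⟩)
      (f.lt_iff_lt.2 (by simp)) (f.lt_iff_lt.2 (by simp [Fin.lt_def]))
      (h0.symm.trans h2)
    rw [Fin.getElem_fin, Fin.getElem_fin, ← h0, ← h1] at this
    exact this
  · intro h i k j hik hkj hij
    refine h _ _ ?_
    have hs : [w[i], w[k], w[j]].Sublist w := by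
      have := List.map_getElem_sublist (l := w) (is := [i, k, j]) (by
        simp [List.pairwise_cons, hik, hkj, hik.trans hkj])
      simpa using this
    rw [← hij] at hs
    exact hs

theorem mem_Q {n : ℕ} {m : Fin n → ℕ} {w : List ℕ} :
    w ∈ Q m ↔ (w : Multiset ℕ) = letters m ∧ IsStirling w := by
  rw [Q, Finset.mem_filter, Multiset.mem_toFinset, Multiset.mem_lists_iff, eq_comm]
  rfl

theorem letters_succ {n : ℕ} (m : Fin (n + 1) → ℕ) :
    letters m = letters (Fin.init m) + Multiset.replicate (m (Fin.last n)) (n + 1) := by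
  rw [letters, Fin.sum_univ_castSucc]
  rfl

theorem lt_of_mem_letters {n : ℕ} {m : Fin n → ℕ} {a : ℕ} (ha : a ∈ letters m) : a < n + 1 := by
  rw [letters, Multiset.mem_sum] at ha
  obtain ⟨k, -, hk⟩ := ha
  rw [Multiset.eq_of_mem_replicate hk]
  have := k.2
  omega

theorem lt_of_mem_Q {n : ℕ} {m : Fin n → ℕ} {v : List ℕ} (hv : v ∈ Q m) :
    ∀ a ∈ v, a < n + 1 := by
  intro a ha
  refine lt_of_mem_letters (m := m) ?_
  rw [← (mem_Q.1 hv).1]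
  exact ha

theorem length_of_mem_Q {n : ℕ} {m : Fin n → ℕ} {v : List ℕ} (hv : v ∈ Q m) :
    v.length = ∑ k, m k := by
  rw [← Multiset.coe_card, (mem_Q.1 hv).1, letters, Multiset.card_sum]
  simp

theorem coe_insertBlock (N k : ℕ) (v : List ℕ) (j : ℕ) :
    (insertBlock N k v j : Multiset ℕ) = v + Multiset.replicate k N := by
  rw [insertBlock, ← Multiset.coe_add, ← Multiset.coe_add, Multiset.coe_replicate, add_left_comm,
    Multiset.coe_add, List.take_append_drop, add_comm]

theorem filter_insertBlock {N : ℕ} (k : ℕ) {v : List ℕ} (hv : N ∉ v) (j : ℕ) :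
    (insertBlock N k v j).filter (· ≠ N) = v := by
  have h : ∀ l : List ℕ, (∀ a ∈ l, a ∈ v) → l.filter (· ≠ N) = l := by
    intro l hl
    refine List.filter_eq_self.2 fun a ha => ?_
    have : a ≠ N := fun h => hv (h ▸ hl a ha)
    simpa using this
  rw [insertBlock, List.filter_append, List.filter_append,
    h _ fun a ha => List.mem_of_mem_take ha, h _ fun a ha => List.mem_of_mem_drop ha]
  simp

theorem idxOf_insertBlock {N k : ℕ} (hk : 0 < k) {v : List ℕ} (hv : N ∉ v) {j : ℕ}
    (hj : j ≤ v.length) : (insertBlock N k v j).idxOf N = j := by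
  obtain ⟨s, rfl⟩ := Nat.exists_eq_succ_of_ne_zero hk.ne'
  rw [insertBlock, List.idxOf_append_of_notMem fun h => hv (List.mem_of_mem_take h)]
  simp [List.replicate_succ, hj]

theorem isStirling_insertBlock {N : ℕ} (k : ℕ) {v : List ℕ} (hv : ∀ a ∈ v, a < N)
    (hs : IsStirling v) (j : ℕ) : IsStirling (insertBlock N k v j) := by
  have hNv : N ∉ v := fun h => lt_irrefl _ (hv N h)
  rw [isStirling_iff_sublist] at hs ⊢
  intro a b h
  have hmem : ∀ c ∈ insertBlock N k v j, c ≤ N := by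
    intro c hc
    have hc' : c ∈ (insertBlock N k v j : Multiset ℕ) := hc
    rw [coe_insertBlock, Multiset.mem_add] at hc'
    rcases hc' with hc' | hc'
    · exact (hv c hc').le
    · exact (Multiset.eq_of_mem_replicate hc').le
  by_cases hb : b = N
  · rw [hb]
    exact hmem a (h.subset (by simp))
  by_cases ha : a = N
  · subst ha
    exfalso
    rw [insertBlock, List.sublist_append_iff] at h
    obtain ⟨l₁, l₂, hl, h₁, h₂⟩ := h
    have hl₁ : a ∉ l₁ := fun h' => hNv (List.mem_of_mem_take (h₁.subset h'))
    cases l₁ with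
    | cons c l =>
      simp only [List.cons_append, List.cons.injEq] at hl
      simp [hl.1] at hl₁
    | nil =>
      rw [List.nil_append] at hl
      subst hl
      rw [List.sublist_append_iff] at h₂
      obtain ⟨l₃, l₄, hl, h₃, h₄⟩ := h₂
      have hl₄ : a ∉ l₄ := fun h' => hNv (List.mem_of_mem_drop (h₄.subset h'))
      rcases List.eq_nil_or_concat l₄ with rfl | ⟨l, c, rfl⟩
      · rw [List.append_nil] at hl
        exact hb (List.eq_of_mem_replicate (h₃.subset (hl ▸ by simp)))
      · have := congrArg List.getLast? hl
        simp at this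
        simp [this] at hl₄
  · refine hs a b ?_
    have := h.filter (· ≠ N)
    rw [filter_insertBlock k hNv] at this
    simpa [ha, hb] using this

/-- In a Stirling word the occurrences of the largest letter form a single block. -/
theorem exists_eq_insertBlock {N : ℕ} {w : List ℕ} (hw : ∀ a ∈ w, a ≤ N) (hs : IsStirling w)
    (hN : N ∈ w) : ∃ j ≤ (w.filter (· ≠ N)).length,
      w = insertBlock N (w.count N) (w.filter (· ≠ N)) j := by
  obtain ⟨A, B, rfl, hA⟩ := List.eq_append_cons_of_mem hN
  set C := B.dropWhile (· = N) with hC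
  have hT : B.takeWhile (· = N) = List.replicate (B.takeWhile (· = N)).length N :=
    List.eq_replicate_of_mem fun b hb => by simpa using List.mem_takeWhile_imp hb
  set k := (B.takeWhile (· = N)).length
  have hB : B = List.replicate k N ++ C := by
    rw [← hT, hC, List.takeWhile_append_dropWhile]
  have hNC : N ∉ C := by
    intro hmem
    rcases hC' : C with _ | ⟨c, C'⟩
    · simp [hC'] at hmem
    · have hcN : c ≠ N := by
        have := List.head_dropWhile_not (fun a => decide (a = N)) (l := B) (by rw [← hC, hC']; simp)
        simp only [← hC, hC'] at this
        exact of_decide_eq_false this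
      have hNC' : N ∈ C' := by
        rw [hC', List.mem_cons] at hmem
        exact hmem.resolve_left hcN.symm
      have hcw : c ∈ A ++ N :: B := by rw [hB, hC']; simp
      refine hcN (le_antisymm (hw c hcw) ((isStirling_iff_sublist _).1 hs N c ?_))
      refine List.Sublist.trans ?_ (List.sublist_append_right A _)
      refine List.Sublist.cons_cons N ?_
      rw [hB, hC']
      refine List.Sublist.trans ?_ (List.sublist_append_right _ _)
      exact List.Sublist.cons_cons c (List.singleton_sublist.2 hNC')
  have hw' : A ++ N :: B = insertBlock N (k + 1) (A ++ C) A.length := by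
    rw [insertBlock, hB]
    simp [List.replicate_succ]
  have hNAC : N ∉ A ++ C := by simp [hA, hNC]
  have hcount : (A ++ N :: B).count N = k + 1 := by
    rw [hB]
    simp [List.count_eq_zero_of_not_mem hA, List.count_eq_zero_of_not_mem hNC]
  have hfilter : (A ++ N :: B).filter (· ≠ N) = A ++ C := by
    rw [hw', filter_insertBlock _ hNAC]
  refine ⟨A.length, ?_, ?_⟩
  · rw [hfilter]
    simp
  · rw [hcount, hfilter, hw']

section recursion

variable {n : ℕ} {m : Fin (n + 1) → ℕ}

theorem insertBlock_mem_Q {v : List ℕ} (hv : v ∈ Q (Fin.init m)) (j : ℕ) :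
    insertBlock (n + 1) (m (Fin.last n)) v j ∈ Q m := by
  refine mem_Q.2 ⟨?_, isStirling_insertBlock _ (lt_of_mem_Q hv) (mem_Q.1 hv).2 j⟩
  rw [coe_insertBlock, (mem_Q.1 hv).1, letters_succ]

theorem filter_mem_Q {w : List ℕ} (hw : w ∈ Q m) : w.filter (· ≠ n + 1) ∈ Q (Fin.init m) := by
  rw [mem_Q] at hw ⊢
  constructor
  · rw [← Multiset.filter_coe, hw.1, letters_succ, Multiset.filter_add,
      Multiset.filter_eq_self.2 fun a ha => (lt_of_mem_letters ha).ne,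
      Multiset.filter_eq_nil.2 fun a ha => not_not.2 (Multiset.eq_of_mem_replicate ha), add_zero]
  · rw [isStirling_iff_sublist] at hw ⊢
    exact fun a b h => hw.2 a b (h.trans List.filter_sublist)

theorem count_of_mem_Q {w : List ℕ} (hw : w ∈ Q m) : w.count (n + 1) = m (Fin.last n) := by
  rw [← Multiset.coe_count, (mem_Q.1 hw).1, letters_succ, Multiset.count_add,
    Multiset.count_replicate_self,
    Multiset.count_eq_zero_of_notMem fun h => lt_irrefl _ (lt_of_mem_letters h), zero_add]

/-- Every generalized Stirling permutation arises in exactly one way by inserting the block of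
its largest letter. -/
theorem sum_Q_succ {M : Type*} [AddCommMonoid M] (hm : 0 < m (Fin.last n)) (f : List ℕ → M) :
    ∑ w ∈ Q m, f w = ∑ v ∈ Q (Fin.init m), ∑ j ∈ Finset.range (v.length + 1),
      f (insertBlock (n + 1) (m (Fin.last n)) v j) := by
  have hnot : ∀ v ∈ Q (Fin.init m), n + 1 ∉ v := fun v hv h => lt_irrefl _ (lt_of_mem_Q hv _ h)
  have key : ∀ w ∈ Q m, w.idxOf (n + 1) ≤ (w.filter (· ≠ n + 1)).length ∧
      w = insertBlock (n + 1) (m (Fin.last n)) (w.filter (· ≠ n + 1)) (w.idxOf (n + 1)) := by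
    intro w hw
    have hmem : n + 1 ∈ w := by
      rw [← List.count_pos_iff, count_of_mem_Q hw]
      exact hm
    obtain ⟨j, hj, hwj⟩ := exists_eq_insertBlock
      (fun a ha => Nat.lt_succ_iff.1 (lt_of_mem_Q hw a ha)) (mem_Q.1 hw).2 hmem
    rw [count_of_mem_Q hw] at hwj
    have hidx : w.idxOf (n + 1) = j := by
      conv_lhs => rw [hwj]
      exact idxOf_insertBlock hm (hnot _ (filter_mem_Q hw)) hj
    rw [hidx]
    exact ⟨hj, hwj⟩
  rw [Finset.sum_sigma']
  refine Finset.sum_bij' (fun w _ => ⟨w.filter (· ≠ n + 1), w.idxOf (n + 1)⟩)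
    (fun p _ => insertBlock (n + 1) (m (Fin.last n)) p.1 p.2) ?_ ?_ ?_ ?_ ?_
  · intro w hw
    exact Finset.mem_sigma.2
      ⟨filter_mem_Q hw, Finset.mem_range.2 (Nat.lt_succ_iff.2 (key w hw).1)⟩
  · intro p hp
    exact insertBlock_mem_Q (Finset.mem_sigma.1 hp).1 _
  · intro w hw
    exact (key w hw).2.symm
  · rintro ⟨v, j⟩ hp
    obtain ⟨hv, hj⟩ := Finset.mem_sigma.1 hp
    simp only [filter_insertBlock _ (hnot v hv),
      idxOf_insertBlock hm (hnot v hv) (Nat.lt_succ_iff.1 (Finset.mem_range.1 hj))]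
  · intro w hw
    rw [← (key w hw).2]

end recursion

/-- The joint distribution of descents, ascents and plateaux on `Q m`. -/
def triple {R : Type*} [CommSemiring R] {n : ℕ} (m : Fin n → ℕ) (x y z : R) : R :=
  ∑ w ∈ Q m, x ^ des w * y ^ asc w * z ^ plat w

theorem map_triple {R R' : Type*} [CommSemiring R] [CommSemiring R'] (φ : R →+* R') {n : ℕ}
    (m : Fin n → ℕ) (x y z : R) : φ (triple m x y z) = triple m (φ x) (φ y) (φ z) := by
  simp [triple]

theorem triple_succ {R : Type*} [CommRing R] {n : ℕ} {m : Fin (n + 1) → ℕ}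
    (hm : 0 < m (Fin.last n)) (x y z : R) :
    triple m x y z = z ^ (m (Fin.last n) - 1) * (x * y) *
      (derivative (triple (Fin.init m) (C x + X) (C y + X) (C z + X))).eval 0 := by
  rw [triple, sum_Q_succ hm, triple, derivative_sum, eval_finsetSum, Finset.mul_sum]
  refine Finset.sum_congr rfl fun v hv => ?_
  obtain ⟨k, hk⟩ := Nat.exists_eq_succ_of_ne_zero hm.ne'
  rw [hk, Nat.succ_eq_add_one, sum_insertBlock x y z n.succ_pos (lt_of_mem_Q hv) k]
  simp [derivative_mul, derivative_pow]
  ring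

theorem coeff_triple_line {n : ℕ} (m : Fin n → ℕ) (x y z a b c : ℂ) :
    (triple m (C x + C a * X) (C y + C b * X) (C z + C c * X)).coeff (∑ k, m k + 1) =
      triple m a b c := by
  have hdeg : ∀ (u v : ℂ) (k : ℕ), ((C u + C v * X) ^ k).natDegree ≤ k := fun u v k => by
    have : (C u + C v * X).natDegree ≤ 1 := by
      rw [add_comm]
      exact natDegree_linear_le
    simpa using natDegree_pow_le_of_le k this
  have hcoeff : ∀ (u v : ℂ) (k : ℕ), ((C u + C v * X) ^ k).coeff k = v ^ k := fun u v k => by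
    have : (C u + C v * X).natDegree ≤ 1 := by
      rw [add_comm]
      exact natDegree_linear_le
    have := coeff_pow_of_natDegree_le (m := k) this
    simpa using this
  rw [triple, triple, finsetSum_coeff]
  refine Finset.sum_congr rfl fun w hw => ?_
  rw [← length_of_mem_Q hw, ← des_add_asc_add_plat w,
    coeff_mul_add_eq_of_natDegree_le (natDegree_mul_le_of_le (hdeg _ _ _) (hdeg _ _ _)) (hdeg _ _ _),
    coeff_mul_add_eq_of_natDegree_le (hdeg _ _ _) (hdeg _ _ _), hcoeff, hcoeff, hcoeff]

theorem le_natDegree_triple_line {n : ℕ} {m : Fin n → ℕ} (hQ : (Q m).Nonempty) (x y z : ℂ)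
    {a b c : ℝ} (ha : 0 < a) (hb : 0 < b) (hc : 0 < c) : ∑ k, m k + 1 ≤
      (triple m (C x + C (a : ℂ) * X) (C y + C (b : ℂ) * X) (C z + C (c : ℂ) * X)).natDegree := by
  refine le_natDegree_of_ne_zero ?_
  rw [coeff_triple_line]
  have h : triple m (a : ℂ) b c = ((triple m a b c : ℝ) : ℂ) :=
    (map_triple Complex.ofRealHom m a b c).symm
  rw [h, Complex.ofReal_ne_zero]
  exact (Finset.sum_pos (fun w _ => by positivity) hQ).ne'

theorem eval_triple_line {n : ℕ} (m : Fin n → ℕ) (x y z a b c t : ℂ) :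
    (triple m (C x + C a * X) (C y + C b * X) (C z + C c * X)).eval t =
      triple m (x + a * t) (y + b * t) (z + c * t) := by
  rw [← coe_evalRingHom, map_triple]
  simp

theorem Q_nonempty_of_triple_ne_zero {n : ℕ} {m : Fin n → ℕ} {x y z : ℂ}
    (h : triple m x y z ≠ 0) : (Q m).Nonempty := by
  rw [Finset.nonempty_iff_ne_empty]
  intro h'
  simp [triple, h'] at h

theorem triple_zero {R : Type*} [CommSemiring R] (m : Fin 0 → ℕ) (x y z : R) :
    triple m x y z = z := by
  have hQ : Q m = {[]} := by
    ext w
    rw [mem_Q, letters, Fin.sum_univ_zero, Multiset.coe_eq_zero, Finset.mem_singleton]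
    refine ⟨fun h => h.1, fun h => ⟨h, ?_⟩⟩
    subst h
    exact fun i => i.elim0
  have h1 : des [] = 0 := by decide
  have h2 : asc [] = 0 := by decide
  have h3 : plat [] = 1 := by decide
  simp [triple, hQ, h1, h2, h3]

/-- The trivariate generating polynomial is stable. -/
theorem triple_ne_zero {n : ℕ} {m : Fin n → ℕ} (hm : ∀ k, 1 ≤ m k) {x y z : ℂ}
    (hx : 0 < x.im) (hy : 0 < y.im) (hz : 0 < z.im) : triple m x y z ≠ 0 := by
  have ne_of_im : ∀ {u : ℂ}, 0 < u.im → u ≠ 0 := by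
    rintro u hu rfl
    simp at hu
  induction n generalizing x y z with
  | zero =>
    rw [triple_zero]
    exact ne_of_im hz
  | succ n ih =>
    have ih' := @ih (Fin.init m) fun k => hm _
    rw [triple_succ (hm _)]
    refine mul_ne_zero (mul_ne_zero (pow_ne_zero _ (ne_of_im hz))
      (mul_ne_zero (ne_of_im hx) (ne_of_im hy))) (derivative_eval_ne_zero ?_ ?_ le_rfl)
    · intro t ht
      have := eval_triple_line (Fin.init m) x y z 1 1 1 t
      simp only [map_one, one_mul] at this
      rw [this]
      exact ih' (by rw [Complex.add_im]; linarith) (by rw [Complex.add_im]; linarith)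
        (by rw [Complex.add_im]; linarith)
    · have := le_natDegree_triple_line (Q_nonempty_of_triple_ne_zero (ih' hx hy hz)) x y z
        one_pos one_pos one_pos
      simp only [Complex.ofReal_one, map_one, one_mul] at this
      omega

/-- On lines with positive direction through the open upper half-space, no coefficient of the
trivariate generating polynomial vanishes. -/
theorem coeff_triple_line_ne_zero {n : ℕ} {m : Fin n → ℕ} (hm : ∀ k, 1 ≤ m k) {x y z : ℂ}
    (hx : 0 < x.im) (hy : 0 < y.im) (hz : 0 < z.im) {a b c : ℝ} (ha : 0 < a) (hb : 0 < b)
    (hc : 0 < c) {i : ℕ} (hi : i ≤ ∑ k, m k) :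
    (triple m (C x + C (a : ℂ) * X) (C y + C (b : ℂ) * X) (C z + C (c : ℂ) * X)).coeff i ≠ 0 := by
  refine coeff_ne_zero_of_eval_ne_zero ?_ fun t ht => ?_
  · have := le_natDegree_triple_line
      (Q_nonempty_of_triple_ne_zero (triple_ne_zero hm hx hy hz)) x y z ha hb hc
    omega
  · have him : ∀ {u : ℂ} {d : ℝ}, 0 < u.im → 0 < d → 0 < (u + d * t).im := by
      intro u d hu hd
      rw [Complex.add_im, Complex.im_ofReal_mul]
      have := mul_nonneg hd.le ht
      linarith
    rw [eval_triple_line]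
    exact triple_ne_zero hm (him hx ha) (him hy hb) (him hz hc)

/-- A polynomial family in `ε` and `x` whose specialization at `ε = 0` is `S m i`. -/
noncomputable def perturbedS {n : ℕ} (m : Fin n → ℕ) (i : ℕ) : ℂ[X][X] :=
  (triple (R := ℂ[X][X][X]) m (C X + C (C X) * X)
    (C (1 + C (X * C Complex.I)) + C (C X) * X) (C (C (X * C Complex.I)) + X)).coeff i

theorem evalEval_perturbedS {n : ℕ} (m : Fin n → ℕ) (i : ℕ) (ε x : ℂ) :
    (perturbedS m i).evalEval ε x = (triple m (C x + C ε * X)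
      (C (1 + ε * Complex.I) + C ε * X) (C (ε * Complex.I) + C 1 * X)).coeff i := by
  rw [perturbedS, ← coe_evalEvalRingHom, ← coeff_map, triple, triple, Polynomial.map_sum]
  simp [mul_comm (C ε) (C Complex.I)]

theorem map_perturbedS {n : ℕ} (m : Fin n → ℕ) (i : ℕ) :
    (perturbedS m i).map (evalRingHom 0) = (S m i).map (algebraMap ℝ ℂ) := by
  rw [perturbedS, ← coe_mapRingHom, ← coeff_map, triple, S, Polynomial.map_sum,
    Polynomial.map_sum, Finset.sum_filter, finsetSum_coeff]
  refine Finset.sum_congr rfl fun w _ => ?_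
  have h : ∀ d p : ℕ, ((C (X : ℂ[X])) ^ d * X ^ p).coeff i = if p = i then X ^ d else 0 := by
    intro d p
    rw [← C_pow, coeff_C_mul, coeff_X_pow]
    simp [eq_comm]
  split_ifs with hp <;> simp [h, hp]

theorem aeval_S_ne_zero {n : ℕ} {m : Fin n → ℕ} (hm : ∀ k, 1 ≤ m k) {i : ℕ}
    (hi : i ≤ ∑ k, m k) (hS : S m i ≠ 0) {z : ℂ} (hz : 0 < z.im) : aeval z (S m i) ≠ 0 := by
  intro h0
  refine hS ((Polynomial.map_eq_zero (algebraMap ℝ ℂ)).1 ?_)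
  rw [← map_perturbedS]
  refine map_evalRingHom_zero_of_evalEval_ne_zero hz (z := z) ?_ ?_
  · intro ε hε w hw
    have hw' : 0 < w.im := by
      rw [Metric.mem_ball, dist_eq_norm] at hw
      have h := (Complex.abs_im_le_norm (w - z)).trans_lt hw
      rw [Complex.sub_im] at h
      linarith [(abs_lt.1 h).1]
    rw [evalEval_perturbedS]
    exact_mod_cast coeff_triple_line_ne_zero hm hw' (y := 1 + ε * Complex.I)
      (z := ε * Complex.I) (by simpa using hε) (by simpa using hε) hε hε one_pos hi
  · rw [← map_evalRingHom_eval, map_perturbedS, eval_map_algebraMap, h0]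

end GenStirling

theorem corollary3p3 (n : ℕ) (m : Fin n → ℕ) (hm : ∀ k, 1 ≤ m k)
    (i : ℕ) (hi : i < ∑ k, m k) :
    GenStirling.HasOnlyRealRoots (GenStirling.S m i) := by
  by_cases hS : GenStirling.S m i = 0
  · exact Or.inl hS
  refine Or.inr fun z hz => ?_
  by_contra him
  rcases lt_or_gt_of_ne him with h | h
  · refine GenStirling.aeval_S_ne_zero hm hi.le hS (z := starRingEnd ℂ z) (by simpa using h) ?_
    rw [Polynomial.aeval_conj, hz, map_zero]
  · exact GenStirling.aeval_S_ne_zero hm hi.le hS h hz
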